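/- Assume the Generalized Continuum Hypothesis ($2^{\mu}=\mu^{+}$ for every infinite cardinal $\mu$), and let $\kappa,\lambda$ be cardinals with $\omega_2\le\kappa\le\lambda$. A hypergraph is identified with the family $\mathcal E$ of its edges, which are non-empty sets; its vertex set is $\bigcup\mathcal E$. Let $V$ be a set of cardinality $\lambda$ and let $\mathcal E$ be a hypergraph of subsets of $V$ such that $|E\cap E'|<\omega$ for any two distinct edges $E,E'\in\mathcal E$ (property $C(2,\omega)$). (1) If every edge of $\mathcal E$ has cardinality $\kappa$, then $\mathcal E$ has a maximizing well-ordering, i.e. there is a well-ordering $\preceq$ of $\bigcup\mathcal E$ such that every $E\in\mathcal E$ has a $\preceq$-maximal element. (2) If every edge of $\mathcal E$ is either finite or of cardinality $\kappa$ (that is, $\mathcal E\subseteq[V]^{\omega\cup\{\kappa\}}$), then $\mathcal E$ has a minimal vertex cover, i.e. there is a set $Z\subseteq\bigcup\mathcal E$ that meets every $E\in\mathcal E$, while no proper subset of $Z$ meets every $E\in\mathcal E$. -/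

import Mathlib

universe u

namespace EdgeFamily

open Cardinal

/-- The generalized continuum hypothesis (for the cardinals of the universe `u`). -/
def GCH : Prop :=
  ∀ c : Cardinal.{u}, ℵ₀ ≤ c → (2 : Cardinal.{u}) ^ c = Order.succ c

variable {V : Type u}

/-- `[V]^S`: the subsets of `V` whose cardinality belongs to `S`. -/
def subsetsOfCard (V : Type u) (S : Set Cardinal.{u}) : Set (Set V) :=
  {B | #B ∈ S}

/-- A hypergraph is identified with the family `E` of its edges, which are non-empty sets;
its vertex set is `⋃₀ E`. -/
def IsHypergraph (E : Set (Set V)) : Prop :=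
  ∀ e ∈ E, e.Nonempty

/-- Property `C(k, ρ)`: the intersection of any `k` distinct edges has fewer than `ρ` elements. -/
def PropertyC (E : Set (Set V)) (k : ℕ) (ρ : Cardinal.{u}) : Prop :=
  ∀ E' : Set (Set V), E' ⊆ E → #E' = k → #(⋂₀ E' : Set V) < ρ

/-- `Y` is a vertex cover of `E`: a set of vertices that meets every edge. -/
def IsVertexCover (E : Set (Set V)) (Y : Set V) : Prop :=
  Y ⊆ ⋃₀ E ∧ ∀ e ∈ E, (Y ∩ e).Nonempty

/-- `Z` is a vertex cover no proper subset of which is a vertex cover. -/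
def IsMinimalVertexCover (E : Set (Set V)) (Z : Set V) : Prop :=
  IsVertexCover E Z ∧ ∀ Z' : Set V, Z' ⊂ Z → ¬ IsVertexCover E Z'

/-- `r` is (the strict part of) a well-ordering of the vertex set of `E` for which every edge
has a maximal element. -/
def IsMaximizingWellOrder (E : Set (Set V)) (r : ↥(⋃₀ E) → ↥(⋃₀ E) → Prop) : Prop :=
  IsWellOrder ↥(⋃₀ E) r ∧
    ∀ e ∈ E, ∃ m : ↥(⋃₀ E), (m : V) ∈ e ∧ ∀ x : ↥(⋃₀ E), (x : V) ∈ e → ¬ r m x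

/-- `M(lam, S, k, ρ) → MinVC`: every hypergraph `E ⊆ [V]^S` with property `C(k, ρ)`, where `V` is
a set of cardinality `lam`, has a minimal vertex cover. -/
def MinVC (lam : Cardinal.{u}) (S : Set Cardinal.{u}) (k : ℕ) (ρ : Cardinal.{u}) : Prop :=
  ∀ V : Type u, #V = lam → ∀ E : Set (Set V), IsHypergraph E → E ⊆ subsetsOfCard V S →
    PropertyC E k ρ → ∃ Z : Set V, IsMinimalVertexCover E Z

/-- `M(lam, S, k, ρ) → MaxWO`: every hypergraph `E ⊆ [V]^S` with property `C(k, ρ)`, where `V` is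
a set of cardinality `lam`, has a maximizing well-ordering. -/
def MaxWO (lam : Cardinal.{u}) (S : Set Cardinal.{u}) (k : ℕ) (ρ : Cardinal.{u}) : Prop :=
  ∀ V : Type u, #V = lam → ∀ E : Set (Set V), IsHypergraph E → E ⊆ subsetsOfCard V S →
    PropertyC E k ρ → ∃ r : ↥(⋃₀ E) → ↥(⋃₀ E) → Prop, IsMaximizingWellOrder E r

end EdgeFamily

/- Fix an infinite `ρ` and call a set edge-closed if it contains every edge that it meets in more
than `ρ` points. If `2 ^ μ = μ⁺` for all infinite `μ`, a set of size `ν ≥ κ` meets at most `ν` edges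
in more than `ρ` points, because such an edge is determined by `ρ` points of it lying in a proper
initial segment; so closing off preserves the size `ν`.

Induct on the number `μ` of vertices. If `μ ≤ κ`, there are at most `κ` edges: enumerate them in
type at most `κ` and pick from each one a point outside all earlier ones. If `μ > κ`, exhaust the
vertex set by an increasing chain of edge-closed sets of size less than `μ`. An edge lies inside the
first member of the chain that meets it in more than `ρ` points, and the union of the preceding
members contains at most `ρ⁺ < κ` points of it. The rest of the edge, of size `κ`, lies in a single
layer of the chain, where the induction hypothesis applies; stacking the well-orderings of the
layers gives the result. -/

namespace EdgeFamily

open Cardinal Order Set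

section CardinalArithmetic

variable {V : Type u} {ρ ν : Cardinal.{u}}

theorem GCH.power_le (hGCH : GCH.{u}) (hν : ℵ₀ < ν) (hρ : ρ < ν) {c : Cardinal.{u}} (hc : c < ν) :
    c ^ ρ ≤ ν := by
  set m := max ℵ₀ (max c ρ)
  have hm : ℵ₀ ≤ m := le_max_left _ _
  calc c ^ ρ ≤ m ^ ρ := power_le_power_right ((le_max_left c ρ).trans (le_max_right _ _))
    _ ≤ m ^ m := power_le_power_left (aleph0_pos.trans_le hm).ne'
      ((le_max_right c ρ).trans (le_max_right _ _))
    _ = succ m := by rw [power_self_eq hm, hGCH m hm]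
    _ ≤ ν := succ_le_of_lt (max_lt hν (max_lt hc hρ))

theorem mk_iUnion_le_of_le {ι : Type*} {s : ι → Set V} (hν : ℵ₀ ≤ ν)
    (hι : lift.{u} #ι ≤ lift ν) (hs : ∀ i, #(s i) ≤ ν) : #(⋃ i, s i) ≤ ν := by
  rw [← lift_le]
  refine (mk_iUnion_le_lift s).trans (mul_le_of_le (aleph0_le_lift.2 hν) hι ?_)
  exact ciSup_le' fun i => lift_le.2 (hs i)

theorem exists_lt_mk_inter_of_lt_mk_inter_iUnion {ι : Type*} [Countable ι] (hρ : ℵ₀ ≤ ρ)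
    {s : ι → Set V} {e : Set V} (h : ρ < #(e ∩ ⋃ i, s i : Set V)) :
    ∃ i, ρ < #(e ∩ s i : Set V) := by
  contrapose! h
  rw [inter_iUnion]
  exact mk_iUnion_le_of_le hρ ((lift_le_aleph0.2 mk_le_aleph0).trans (aleph0_le_lift.2 hρ)) h

theorem mk_iUnion_le_succ_of_monotone {ι : Type*} [LinearOrder ι] (hρ : ℵ₀ ≤ ρ) {s : ι → Set V}
    (hmono : Monotone s) (hs : ∀ i, #(s i) ≤ ρ) : #(⋃ i, s i) ≤ succ ρ := by
  by_contra! h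
  obtain ⟨T, hT, hTρ⟩ := le_mk_iff_exists_subset.1 h.le
  choose i hi using fun t : T => mem_iUnion.1 (hT t.2)
  have hsmall : #(⋃ t, s (i t)) ≤ succ ρ :=
    mk_iUnion_le_of_le (hρ.trans (le_succ ρ)) (by rw [hTρ])
      fun t => (hs (i t)).trans (le_succ ρ)
  obtain ⟨x, hx, hx_notMem⟩ := sdiff_nonempty_of_mk_lt_mk (hsmall.trans_lt h)
  obtain ⟨j, hj⟩ := mem_iUnion.1 hx
  have hTj : T ⊆ s j := fun t ht => by
    rcases le_total (i ⟨t, ht⟩) j with hij | hji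
    · exact hmono hij (hi ⟨t, ht⟩)
    · exact absurd (mem_iUnion.2 ⟨⟨t, ht⟩, hmono hji hj⟩) hx_notMem
  exact (lt_succ ρ).not_ge (hTρ ▸ (mk_le_mk_of_subset hTj).trans (hs j))

theorem exists_le_mk_inter_Iio [LinearOrder V] (hρ : ℵ₀ ≤ ρ) {X : Set V} (hX : ρ < #X) :
    ∃ x, ρ ≤ #(X ∩ Iio x : Set V) := by
  by_contra! hlt
  obtain ⟨T, hTX, hTρ⟩ := le_mk_iff_exists_subset.1 hX.le
  have hIic (t : V) : #(X ∩ Iic t : Set V) ≤ ρ := by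
    have hsub : X ∩ Iic t ⊆ insert t (X ∩ Iio t) := fun y ⟨hyX, hyt⟩ =>
      (mem_Iic.1 hyt).eq_or_lt.imp id fun hy => ⟨hyX, hy⟩
    exact (mk_le_mk_of_subset hsub).trans <| mk_insert_le.trans <|
      add_le_of_le hρ (hlt t).le (one_le_aleph0.trans hρ)
  have hsmall : #(⋃ t : T, X ∩ Iic (t : V)) ≤ ρ :=
    mk_iUnion_le_of_le hρ (by rw [hTρ]) fun t => hIic t
  obtain ⟨x, hxX, hx⟩ := sdiff_nonempty_of_mk_lt_mk (hsmall.trans_lt hX)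
  have hTx : T ⊆ X ∩ Iio x := fun t ht =>
    ⟨hTX ht, not_le.1 fun hxt => hx (mem_iUnion.2 ⟨⟨t, ht⟩, hxX, hxt⟩)⟩
  exact (hlt x).not_ge (hTρ ▸ mk_le_mk_of_subset hTx)

theorem exists_family_of_subsets_of_mk_eq (hρ : ℵ₀ ≤ ρ) (hν : ℵ₀ < ν)
    (hpow : ∀ c < ν, c ^ ρ ≤ ν) {B : Set V} (hB : #B ≤ ν) :
    ∃ P : Set (Set V), #P ≤ ν ∧ (∀ T ∈ P, #T = ρ) ∧
      ∀ X ⊆ B, ρ < #X → ∃ T ∈ P, T ⊆ X := by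
  obtain ⟨_, _, hord⟩ := exists_ord_eq_type_lt B
  let segment (b : B) : Set V := Subtype.val '' Iio b
  have hsegment (b : B) : #(segment b) < ν :=
    mk_image_le.trans_lt ((mk_Iio_lt b hord).trans_le hB)
  refine ⟨⋃ b : B, {T | T ⊆ segment b ∧ #T = ρ}, ?_, ?_, fun X hXB hX => ?_⟩
  · refine mk_iUnion_le_of_le hν.le (by simpa using hB) fun b => ?_
    have hsub : {T | T ⊆ segment b ∧ #T = ρ} ⊆ {T | T ⊆ segment b ∧ #T ≤ ρ} :=
      fun T hT => ⟨hT.1, hT.2.le⟩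
    exact (mk_le_mk_of_subset hsub).trans <| (mk_bounded_subset_le (segment b) ρ).trans <|
      hpow _ (max_lt (hsegment b) hν)
  · rintro T hT
    obtain ⟨b, -, hTρ⟩ := mem_iUnion.1 hT
    exact hTρ
  · have hXB' : #(Subtype.val ⁻¹' X : Set B) = #X :=
      mk_preimage_of_injective_of_subset_range _ _ Subtype.val_injective (by simpa using hXB)
    obtain ⟨b, hb⟩ := exists_le_mk_inter_Iio hρ (hXB' ▸ hX)
    rw [← mk_image_eq Subtype.val_injective] at hb
    obtain ⟨T, hT, hTρ⟩ := le_mk_iff_exists_subset.1 hb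
    refine ⟨T, mem_iUnion.2 ⟨b, hT.trans (image_mono inter_subset_right), hTρ⟩, hT.trans ?_⟩
    exact image_subset_iff.2 inter_subset_left

theorem mk_sdiff_eq_of_mk_inter_lt {e A : Set V} (he : ℵ₀ ≤ #e)
    (h : #(e ∩ A : Set V) < #e) : #(e \ A : Set V) = #e := by
  refine eq_of_add_eq_of_aleph0_le ?_ h he
  rw [← sdiff_self_inter, add_comm, mk_sdiff_add_mk inter_subset_left]

end CardinalArithmetic

section AlmostDisjoint

variable {V : Type u} {E : Set (Set V)} {ρ : Cardinal.{u}}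

theorem propertyC_two_iff :
    PropertyC E 2 ρ ↔ E.Pairwise fun e f => #(e ∩ f : Set V) < ρ := by
  refine ⟨fun h e he f hf hne => ?_, fun h E' hE' hcard => ?_⟩
  · have hpair := h {e, f} (pair_subset he hf) (by
      rw [mk_insert (by simpa using hne), mk_singleton]
      norm_num [one_add_one_eq_two])
    rwa [sInter_pair] at hpair
  · obtain ⟨e, f, hne, -⟩ := mk_eq_two_iff.1 (by simpa using hcard)
    have hsub : ⋂₀ E' ⊆ e ∩ f :=
      subset_inter (sInter_subset_of_mem e.2) (sInter_subset_of_mem f.2)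
    exact (mk_le_mk_of_subset hsub).trans_lt
      (h (hE' e.2) (hE' f.2) (Subtype.coe_ne_coe.2 hne))

theorem PropertyC.mono {F : Set (Set V)} {k : ℕ} (hE : PropertyC E k ρ) (hFE : F ⊆ E) :
    PropertyC F k ρ :=
  fun E' hE' => hE E' (hE'.trans hFE)

theorem PropertyC.image_of_subset (hE : PropertyC E 2 ρ) {φ : Set V → Set V}
    (hφ : ∀ e ∈ E, φ e ⊆ e) : PropertyC (φ '' E) 2 ρ := by
  rw [propertyC_two_iff] at hE ⊢
  rintro _ ⟨e, he, rfl⟩ _ ⟨f, hf, rfl⟩ hne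
  exact (mk_le_mk_of_subset (inter_subset_inter (hφ e he) (hφ f hf))).trans_lt
    (hE he hf (ne_of_apply_ne φ hne))

theorem PropertyC.mk_setOf_lt_mk_inter_le (hE : PropertyC E 2 ρ) (hρ : ℵ₀ ≤ ρ)
    {ν : Cardinal.{u}} (hν : ℵ₀ < ν) (hpow : ∀ c < ν, c ^ ρ ≤ ν) {B : Set V} (hB : #B ≤ ν) :
    #{e ∈ E | ρ < #(e ∩ B : Set V)} ≤ ν := by
  obtain ⟨P, hPν, hPρ, hP⟩ := exists_family_of_subsets_of_mk_eq hρ hν hpow hB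
  choose T hTP hT using fun e : {e ∈ E | ρ < #(e ∩ B : Set V)} =>
    hP (e ∩ B) inter_subset_right e.2.2
  have hT_inj : Function.Injective fun e => (⟨T e, hTP e⟩ : P) := by
    intro e f hef
    have hTef : T e = T f := congrArg Subtype.val hef
    by_contra hne
    have hsub : T e ⊆ e ∩ f := subset_inter ((hT e).trans inter_subset_left)
      (hTef ▸ (hT f).trans inter_subset_left)
    exact (propertyC_two_iff.1 hE e.2.1 f.2.1 (Subtype.coe_ne_coe.2 hne)).not_ge
      ((hPρ _ (hTP e)).symm.trans_le (mk_le_mk_of_subset hsub))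
  exact (mk_le_of_injective hT_inj).trans hPν

end AlmostDisjoint

section EdgeClosed

variable {V : Type u} {E : Set (Set V)} {ρ : Cardinal.{u}}

/-- `A` is edge-closed if it contains every edge that it meets in more than `ρ` points. -/
def IsEdgeClosed (ρ : Cardinal.{u}) (E : Set (Set V)) (A : Set V) : Prop :=
  ∀ e ∈ E, ρ < #(e ∩ A : Set V) → e ⊆ A

theorem isEdgeClosed_sInter {𝒜 : Set (Set V)} (h𝒜 : ∀ A ∈ 𝒜, IsEdgeClosed ρ E A) :
    IsEdgeClosed ρ E (⋂₀ 𝒜) := fun e he hlt =>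
  subset_sInter fun A hA => h𝒜 A hA e he <| hlt.trans_le <|
    mk_le_mk_of_subset (inter_subset_inter_right e (sInter_subset_of_mem hA))

/-- The least edge-closed set containing a given set, as a closure operator. -/
def edgeClosure (ρ : Cardinal.{u}) (E : Set (Set V)) : ClosureOperator (Set V) :=
  .ofCompletePred (IsEdgeClosed ρ E) fun _ => isEdgeClosed_sInter

theorem isEdgeClosed_edgeClosure (B : Set V) : IsEdgeClosed ρ E (edgeClosure ρ E B) :=
  (edgeClosure ρ E).isClosed_closure B

theorem PropertyC.exists_isEdgeClosed_superset (hE : PropertyC E 2 ρ) (hρ : ℵ₀ ≤ ρ)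
    {ν : Cardinal.{u}} (hν : ℵ₀ < ν) (hpow : ∀ c < ν, c ^ ρ ≤ ν) (hcard : ∀ e ∈ E, #e ≤ ν)
    {B : Set V} (hB : #B ≤ ν) : ∃ A, B ⊆ A ∧ IsEdgeClosed ρ E A ∧ #A ≤ ν := by
  let step (A : Set V) : Set V := A ∪ ⋃₀ {e ∈ E | ρ < #(e ∩ A : Set V)}
  have hstep (A : Set V) (hA : #A ≤ ν) : #(step A) ≤ ν := by
    refine (mk_union_le _ _).trans (add_le_of_le hν.le hA ?_)
    rw [sUnion_eq_iUnion]
    exact mk_iUnion_le_of_le hν.le (lift_le.2 (hE.mk_setOf_lt_mk_inter_le hρ hν hpow hA))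
      fun e => hcard e e.2.1
  have hiter (n : ℕ) : #(step^[n] B) ≤ ν :=
    Function.Iterate.rec (fun A : Set V => #A ≤ ν) hB hstep n
  refine ⟨⋃ n, step^[n] B, subset_iUnion (fun n => step^[n] B) 0, fun e he hlt => ?_, ?_⟩
  · obtain ⟨n, hn⟩ := exists_lt_mk_inter_of_lt_mk_inter_iUnion hρ hlt
    have hmem : e ∈ {e ∈ E | ρ < #(e ∩ step^[n] B : Set V)} := ⟨he, hn⟩
    have he_step : e ⊆ step^[n + 1] B := by
      rw [Function.iterate_succ_apply']
      exact subset_union_of_subset_right (subset_sUnion_of_mem hmem) _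
    exact he_step.trans (subset_iUnion (fun n => step^[n] B) (n + 1))
  · exact mk_iUnion_le_of_le hν.le (by simpa using hν.le) hiter

theorem PropertyC.mk_edgeClosure_le (hE : PropertyC E 2 ρ) (hρ : ℵ₀ ≤ ρ)
    {ν : Cardinal.{u}} (hν : ℵ₀ < ν) (hpow : ∀ c < ν, c ^ ρ ≤ ν) (hcard : ∀ e ∈ E, #e ≤ ν)
    {B : Set V} (hB : #B ≤ ν) : #(edgeClosure ρ E B) ≤ ν := by
  obtain ⟨A, hBA, hA, hAν⟩ := hE.exists_isEdgeClosed_superset hρ hν hpow hcard hB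
  exact (mk_le_mk_of_subset (ClosureOperator.closure_min hBA hA)).trans hAν

theorem PropertyC.exists_edgeClosed_filtration (hE : PropertyC E 2 ρ) (hρ : ℵ₀ ≤ ρ)
    {κ : Cardinal.{u}} (hκ : ℵ₀ < κ) (hpow : ∀ ν ≥ κ, ∀ c < ν, c ^ ρ ≤ ν)
    (hcard : ∀ e ∈ E, #e ≤ κ) {W : Set V} (hW : κ < #W) :
    ∃ (_ : LinearOrder W) (_ : WellFoundedLT W) (C : W → Set V), Monotone C ∧
      (∀ x, IsEdgeClosed ρ E (C x)) ∧ (∀ x, #(C x) < #W) ∧ W ⊆ ⋃ x, C x := by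
  obtain ⟨hlin, hwf, hord⟩ := exists_ord_eq_type_lt W
  refine ⟨hlin, hwf, fun x => edgeClosure ρ E (Subtype.val '' Iic x), fun x y hxy => ?_,
    fun x => isEdgeClosed_edgeClosure _, fun x => ?_, fun x hx => ?_⟩
  · exact (edgeClosure ρ E).monotone (image_mono (Iic_subset_Iic.2 hxy))
  · have hmax : κ ≤ max κ #(Iic x) := le_max_left _ _
    refine (hE.mk_edgeClosure_le hρ (hκ.trans_le hmax) (hpow _ hmax)
      (fun e he => (hcard e he).trans hmax) (mk_image_le.trans (le_max_right _ _))).trans_lt ?_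
    exact max_lt hW (mk_Iic_lt x hord (hκ.trans hW).le)
  · exact mem_iUnion.2 ⟨⟨x, hx⟩, (edgeClosure ρ E).le_closure _ ⟨⟨x, hx⟩, self_mem_Iic, rfl⟩⟩

end EdgeClosed

section MaximizingWellOrder

/-- Every edge of `E` has a maximal element for a suitable well-ordering. The whole type `V` is
well-ordered, rather than the vertex set `⋃₀ E` alone, so that the orderings obtained for several
families on `V` can be combined. -/
def HasMaximizingWellOrder {V : Type*} (E : Set (Set V)) : Prop :=
  ∃ r : V → V → Prop, IsWellOrder V r ∧ ∀ e ∈ E, ∃ m ∈ e, ∀ x ∈ e, ¬ r m x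

variable {V ι : Type*} {E : Set (Set V)} [LinearOrder ι] [WellFoundedLT ι]

theorem HasMaximizingWellOrder.mono {F : Set (Set V)} (hE : HasMaximizingWellOrder E)
    (hFE : F ⊆ E) : HasMaximizingWellOrder F := by
  obtain ⟨r, hr, hmax⟩ := hE
  exact ⟨r, hr, fun e he => hmax e (hFE he)⟩

theorem HasMaximizingWellOrder.exists_isMaximizingWellOrder (h : HasMaximizingWellOrder E) :
    ∃ r, IsMaximizingWellOrder E r := by
  obtain ⟨r, hr, hmax⟩ := h
  refine ⟨Subrel r (· ∈ ⋃₀ E), inferInstance, fun e he => ?_⟩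
  obtain ⟨m, hm, hmx⟩ := hmax e he
  exact ⟨⟨m, e, he, hm⟩, hm, fun x hx => hmx x hx⟩

theorem exists_forall_not_rel_of_finite (r : V → V → Prop) [IsWellOrder V r] {e : Set V}
    (he : e.Finite) (hne : e.Nonempty) : ∃ m ∈ e, ∀ x ∈ e, ¬ r m x := by
  classical
  let _ : LinearOrder V := linearOrderOfSTO r
  obtain ⟨m, hm⟩ := he.exists_maximal hne
  exact ⟨m, hm.prop, fun x hx => hm.not_gt hx⟩

theorem HasMaximizingWellOrder.of_infinite (hne : IsHypergraph E)
    (h : HasMaximizingWellOrder {e ∈ E | e.Infinite}) : HasMaximizingWellOrder E := by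
  obtain ⟨r, hr, hmax⟩ := h
  refine ⟨r, hr, fun e he => ?_⟩
  rcases e.finite_or_infinite with hfin | hinf
  · exact exists_forall_not_rel_of_finite r hfin (hne e he)
  · exact hmax e ⟨he, hinf⟩

theorem isWellOrder_sigmaLex_onFun (L : V → ι) (r : ι → V → V → Prop)
    [∀ i, IsWellOrder V (r i)] :
    IsWellOrder V ((Sigma.Lex (· < ·) r).onFun fun x => (⟨L x, x⟩ : Σ _ : ι, V)) where
  wf := WellFounded.sigma_lex_of_wellFoundedOn_fiber (f := L) (g := fun _ x => x)
    wellFounded_lt.onFun fun i => (IsWellFounded.wf (r := r i)).wellFoundedOn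
  trichotomous := (Function.Injective.trichotomous_onFun (Sigma.Lex (· < ·) r)
    fun x y hxy => by simpa using (Sigma.mk.inj_iff.1 hxy).2).trichotomous

theorem HasMaximizingWellOrder.of_fibers (L : V → ι)
    (htop : ∀ e ∈ E, ∃ i, IsGreatest (L '' e) i)
    (hfiber : ∀ i,
      HasMaximizingWellOrder ((· ∩ L ⁻¹' {i}) '' {e ∈ E | IsGreatest (L '' e) i})) :
    HasMaximizingWellOrder E := by
  choose r hr hmax using hfiber
  refine ⟨_, isWellOrder_sigmaLex_onFun L r, fun e he => ?_⟩
  obtain ⟨i, hi⟩ := htop e he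
  obtain ⟨m, ⟨hme, rfl⟩, hm_max⟩ := hmax i _ ⟨e, ⟨he, hi⟩, rfl⟩
  refine ⟨m, hme, fun x hx hmx => ?_⟩
  rw [Function.onFun, Sigma.lex_iff] at hmx
  obtain hlt | ⟨heq : L m = L x, hmx⟩ := hmx
  · exact (hi.2 (mem_image_of_mem L hx)).not_gt hlt
  · exact hm_max x ⟨hx, heq.symm⟩ (by rw [heq]; simpa using hmx)

theorem HasMaximizingWellOrder.of_cover (C : ι → Set V)
    (hcover : ∀ e ∈ E, ∃ i, e ⊆ C i ∧ ¬ e ⊆ ⋃ j : Iio i, C j)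
    (hlayer : ∀ i, HasMaximizingWellOrder
      ((· \ ⋃ j : Iio i, C j) '' {e ∈ E | e ⊆ C i ∧ ¬ e ⊆ ⋃ j : Iio i, C j})) :
    HasMaximizingWellOrder E := by
  rcases E.eq_empty_or_nonempty with rfl | ⟨e₀, he₀⟩
  · exact ⟨WellOrderingRel, WellOrderingRel.isWellOrder, by simp⟩
  have : Nonempty ι := (hcover e₀ he₀).nonempty
  choose! L hL using fun (x : V) (hx : ∃ i, x ∈ C i) => exists_minimal_of_wellFoundedLT _ hx
  have hL_le {x i} (hx : x ∈ C i) : L x ≤ i :=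
    not_lt.1 fun hlt => (hL x ⟨i, hx⟩).not_lt hx hlt
  have hL_lt {x i} (hx : x ∈ C i) : L x < i ↔ x ∈ ⋃ j : Iio i, C j := by
    refine ⟨fun hlt => mem_iUnion.2 ⟨⟨L x, hlt⟩, (hL x ⟨i, hx⟩).prop⟩, fun h => ?_⟩
    obtain ⟨⟨j, hj⟩, hxj⟩ := mem_iUnion.1 h
    exact (hL_le hxj).trans_lt hj
  have hgreatest {e i} (he : e ⊆ C i) (hne : ¬ e ⊆ ⋃ j : Iio i, C j) :
      IsGreatest (L '' e) i := by
    obtain ⟨x, hx, hxi⟩ := not_subset.1 hne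
    refine ⟨⟨x, hx, (hL_le (he hx)).eq_of_not_lt (mt (hL_lt (he hx)).1 hxi)⟩, ?_⟩
    rintro _ ⟨y, hy, rfl⟩
    exact hL_le (he hy)
  refine .of_fibers L (fun e he => (hcover e he).imp fun i hi => hgreatest hi.1 hi.2)
    fun i => (hlayer i).mono ?_
  rintro _ ⟨e, ⟨he, hi⟩, rfl⟩
  obtain ⟨j, hj, hne⟩ := hcover e he
  obtain rfl := hi.unique (hgreatest hj hne)
  refine ⟨e, ⟨he, hj, hne⟩, ?_⟩
  ext x
  refine and_congr_right fun hx => ?_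
  rw [← hL_lt (hj hx), (hL_le (hj hx)).not_lt_iff_eq]
  rfl

theorem HasMaximizingWellOrder.range_of_forall_exists_notMem {e : ι → Set V}
    (h : ∀ i, ∃ m ∈ e i, ∀ j < i, m ∉ e j) : HasMaximizingWellOrder (range e) := by
  choose m hm hm_notMem using h
  have hm_inj : Function.Injective m := .of_lt_imp_ne fun i j hij hmij =>
    hm_notMem j i hij (hmij ▸ hm i)
  let L : V → WithBot ι := Function.extend m (↑) fun _ => ⊥
  have hLm (i : ι) : L (m i) = i := hm_inj.extend_apply _ _ i
  have hL {i x} (hx : x ∈ e i) (hxm : x ≠ m i) : L x < i := by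
    by_cases hxr : ∃ j, m j = x
    · obtain ⟨j, rfl⟩ := hxr
      rw [hLm, WithBot.coe_lt_coe]
      exact lt_of_le_of_ne (not_lt.1 fun hij => hm_notMem j i hij hx) fun hji => hxm (hji ▸ rfl)
    · exact (Function.extend_apply' _ _ _ hxr).trans_lt (WithBot.bot_lt_coe i)
  have hgreatest (i : ι) : IsGreatest (L '' e i) i := by
    refine ⟨⟨m i, hm i, hLm i⟩, ?_⟩
    rintro _ ⟨x, hx, rfl⟩
    rcases eq_or_ne x (m i) with rfl | hxm
    · exact (hLm i).le
    · exact (hL hx hxm).le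
  refine .of_fibers L (forall_mem_range.2 fun i => ⟨i, hgreatest i⟩) fun _ =>
    ⟨WellOrderingRel, WellOrderingRel.isWellOrder, ?_⟩
  rintro _ ⟨_, ⟨⟨i, rfl⟩, hi⟩, rfl⟩
  obtain rfl := hi.unique (hgreatest i)
  refine ⟨m i, ⟨hm i, hLm i⟩, fun x ⟨hx, hLx⟩ => ?_⟩
  obtain rfl : x = m i := by_contra fun hxm => (hL hx hxm).ne hLx
  exact irrefl _

/- `Z` is chosen greedily along the well-ordering: a vertex enters `Z` if it is the maximum of an
edge that misses the part of `Z` chosen before it. Such an edge then meets `Z` in that vertex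
alone, which makes `Z` minimal. -/
theorem HasMaximizingWellOrder.exists_isMinimalVertexCover (h : HasMaximizingWellOrder E) :
    ∃ Z, IsMinimalVertexCover E Z := by
  obtain ⟨r, hr, hmax⟩ := h
  let Z : V → Prop := hr.wf.fix fun x Z =>
    ∃ e ∈ E, x ∈ e ∧ (∀ y ∈ e, ¬ r x y) ∧ ∀ y (hy : r y x), y ∈ e → ¬ Z y hy
  have hZ (x : V) :
      Z x ↔ ∃ e ∈ E, x ∈ e ∧ (∀ y ∈ e, ¬ r x y) ∧ ∀ y, r y x → y ∈ e → ¬ Z y :=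
    iff_of_eq (hr.wf.fix_eq _ x)
  refine ⟨{x | Z x}, ⟨fun x hx => ?_, fun e he => ?_⟩, fun Z' hZ' hcov => ?_⟩
  · obtain ⟨e, he, hxe, -⟩ := (hZ x).1 hx
    exact ⟨e, he, hxe⟩
  · obtain ⟨m, hme, hm⟩ := hmax e he
    by_cases hmeet : ∃ y ∈ e, Z y
    · obtain ⟨y, hy, hZy⟩ := hmeet
      exact ⟨y, hZy, hy⟩
    · exact ⟨m, (hZ m).2 ⟨e, he, hme, hm, fun y _ hy hZy => hmeet ⟨y, hy, hZy⟩⟩, hme⟩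
  · obtain ⟨x, hx, hxZ'⟩ := exists_of_ssubset hZ'
    obtain ⟨e, he, -, hx_max, hx_first⟩ := (hZ x).1 hx
    obtain ⟨y, hyZ', hye⟩ := hcov.2 e he
    rcases trichotomous_of r x y with hxy | rfl | hyx
    · exact hx_max y hye hxy
    · exact hxZ' hyZ'
    · exact hx_first y hyx hye (hZ'.1 hyZ')

end MaximizingWellOrder

section AlmostDisjointWellOrder

variable {V : Type u} {E : Set (Set V)} {ρ κ : Cardinal.{u}}

theorem PropertyC.hasMaximizingWellOrder_of_mk_le (hE : PropertyC E 2 ρ) (hκ : ℵ₀ ≤ κ)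
    (hρκ : ρ < κ) (hcard : ∀ e ∈ E, κ ≤ #e) (hEκ : #E ≤ κ) : HasMaximizingWellOrder E := by
  obtain ⟨_, _, hord⟩ := exists_ord_eq_type_lt (#E).out
  let edge : (#E).out → Set V := Subtype.val ∘ outMkEquiv
  have hrange : range edge = E :=
    (outMkEquiv.surjective.range_comp Subtype.val).trans Subtype.range_coe
  have hedge_inj : Function.Injective edge := Subtype.val_injective.comp outMkEquiv.injective
  rw [← hrange]
  refine .range_of_forall_exists_notMem fun i => ?_
  have hinter (j : Iio i) : #(edge i ∩ edge j : Set V) ≤ ρ :=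
    (propertyC_two_iff.1 hE (outMkEquiv i).2 (outMkEquiv j.1).2 (hedge_inj.ne j.2.ne')).le
  have hIio : #(Iio i) < κ := (mk_Iio_lt i hord).trans_le ((mk_out _).trans_le hEκ)
  have hsmall : #(⋃ j : Iio i, edge i ∩ edge j) < #(edge i) :=
    (mk_iUnion_le _).trans_lt <| (mul_lt_of_lt hκ hIio
      ((ciSup_le' hinter).trans_lt hρκ)).trans_le (hcard _ (outMkEquiv i).2)
  obtain ⟨m, hm, hm_notMem⟩ := sdiff_nonempty_of_mk_lt_mk hsmall
  exact ⟨m, hm, fun j hj hmj => hm_notMem (mem_iUnion.2 ⟨⟨j, hj⟩, hm, hmj⟩)⟩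

theorem mk_inter_iUnion_le_succ {ι : Type*} [LinearOrder ι] (hρ : ℵ₀ ≤ ρ) {C : ι → Set V}
    (hmono : Monotone C) (hC : ∀ i, IsEdgeClosed ρ E (C i)) {e : Set V} (he : e ∈ E)
    (hne : ∀ i, ¬ e ⊆ C i) : #(e ∩ ⋃ i, C i : Set V) ≤ succ ρ := by
  rw [inter_iUnion]
  exact mk_iUnion_le_succ_of_monotone hρ
    (fun i j hij => inter_subset_inter_right e (hmono hij))
    fun i => not_lt.1 fun hlt => hne i (hC i e he hlt)

theorem exists_subset_and_not_subset_iUnion_Iio {ι : Type*} [LinearOrder ι] [WellFoundedLT ι]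
    (hρ : ℵ₀ ≤ ρ) {C : ι → Set V} (hmono : Monotone C) (hC : ∀ i, IsEdgeClosed ρ E (C i))
    {e : Set V} (he : e ∈ E) (hcover : e ⊆ ⋃ i, C i) (hlt : succ ρ < #e) :
    ∃ i, e ⊆ C i ∧ ¬ e ⊆ ⋃ j : Iio i, C j := by
  have hex : ∃ i, e ⊆ C i := by
    by_contra! hne
    have hle := mk_inter_iUnion_le_succ hρ hmono hC he hne
    rw [inter_eq_left.2 hcover] at hle
    exact hle.not_gt hlt
  obtain ⟨i, hi⟩ := exists_minimal_of_wellFoundedLT _ hex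
  refine ⟨i, hi.prop, fun hsub => ?_⟩
  have hle := mk_inter_iUnion_le_succ hρ (hmono.comp (Subtype.mono_coe (· ∈ Iio i)))
    (fun j => hC j) he fun j hj => hi.not_lt hj j.2
  exact (inter_eq_left.2 hsub ▸ hle).not_gt hlt

theorem PropertyC.hasMaximizingWellOrder_of_filtration {ι : Type*} [LinearOrder ι]
    [WellFoundedLT ι] (hE : PropertyC E 2 ρ) (hρ : ℵ₀ ≤ ρ) (hκ : succ ρ < κ)
    (hcard : ∀ e ∈ E, #e = κ) {C : ι → Set V} (hmono : Monotone C)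
    (hC : ∀ i, IsEdgeClosed ρ E (C i)) (hcover : ⋃₀ E ⊆ ⋃ i, C i)
    (hlayer : ∀ i, ∀ F : Set (Set V), ⋃₀ F ⊆ C i → PropertyC F 2 ρ → (∀ f ∈ F, #f = κ) →
      HasMaximizingWellOrder F) :
    HasMaximizingWellOrder E := by
  refine .of_cover C (fun e he => ?_) fun i => hlayer i _ (sUnion_subset ?_) ?_ ?_
  · exact exists_subset_and_not_subset_iUnion_Iio hρ hmono hC he
      ((subset_sUnion_of_mem he).trans hcover) (hκ.trans_eq (hcard e he).symm)
  · rintro _ ⟨e, ⟨-, hei, -⟩, rfl⟩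
    exact sdiff_subset.trans hei
  · exact (hE.mono (sep_subset _ _)).image_of_subset fun e _ => sdiff_subset
  · rintro _ ⟨e, ⟨he, -, hne⟩, rfl⟩
    have hsmall := mk_inter_iUnion_le_succ hρ (hmono.comp (Subtype.mono_coe (· ∈ Iio i)))
      (fun j => hC j) he fun j hj => hne (subset_iUnion_of_subset j hj)
    have hinf : ℵ₀ ≤ κ := (hρ.trans (le_succ ρ)).trans hκ.le
    rw [← hcard e he] at hκ hinf ⊢
    exact mk_sdiff_eq_of_mk_inter_lt hinf (hsmall.trans_lt hκ)

theorem PropertyC.hasMaximizingWellOrder (hE : PropertyC E 2 ρ) (hρ : ℵ₀ ≤ ρ) (hκ : succ ρ < κ)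
    (hpow : ∀ ν ≥ κ, ∀ c < ν, c ^ ρ ≤ ν) (hcard : ∀ e ∈ E, #e = κ) :
    HasMaximizingWellOrder E := by
  have hρκ : ρ < κ := (lt_succ ρ).trans hκ
  have h0κ : ℵ₀ < κ := hρ.trans_lt hρκ
  induction hμ : #(⋃₀ E) using WellFoundedLT.induction generalizing E with | ind μ ih
  rcases le_or_gt μ κ with hle | hlt
  · refine hE.hasMaximizingWellOrder_of_mk_le h0κ.le hρκ (fun e he => (hcard e he).ge) ?_
    refine (mk_le_mk_of_subset ?_).trans
      (hE.mk_setOf_lt_mk_inter_le hρ h0κ (hpow κ le_rfl) (hμ.trans_le hle))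
    refine fun e he => ⟨he, ?_⟩
    rwa [inter_eq_left.2 (subset_sUnion_of_mem he), hcard e he]
  · obtain ⟨_, _, C, hmono, hC, hCμ, hcover⟩ := hE.exists_edgeClosed_filtration hρ h0κ hpow
      (fun e he => (hcard e he).le) (hμ ▸ hlt)
    refine hE.hasMaximizingWellOrder_of_filtration hρ hκ hcard hmono hC hcover
      fun x F hFC hF hFcard => ?_
    exact ih _ ((mk_le_mk_of_subset hFC).trans_lt ((hCμ x).trans_eq hμ)) hF hFcard rfl

end AlmostDisjointWellOrder

end EdgeFamily

open EdgeFamily Cardinal in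
theorem mainTheorem2_general {ρ κ : Cardinal.{u}} (lam : Cardinal.{u}) (hρ : ℵ₀ ≤ ρ)
    (hκ : Order.succ ρ < κ) (hpow : ∀ ν ≥ κ, ∀ c < ν, c ^ ρ ≤ ν) :
    MaxWO lam {κ} 2 ρ ∧ MinVC lam (Set.Iio ℵ₀ ∪ {κ}) 2 ρ := by
  refine ⟨fun V _ E _ hEκ hE => ?_, fun V _ E hne hEκ hE => ?_⟩
  · exact (hE.hasMaximizingWellOrder hρ hκ hpow hEκ).exists_isMaximizingWellOrder
  · have hinfinite (e) (he : e ∈ {e ∈ E | e.Infinite}) : #e = κ :=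
      (hEκ he.1).resolve_left fun hfin => he.2 (lt_aleph0_iff_set_finite.1 hfin)
    have hwo := (hE.mono (Set.sep_subset _ _)).hasMaximizingWellOrder hρ hκ hpow hinfinite
    exact (hwo.of_infinite hne).exists_isMinimalVertexCover

theorem mainTheorem2 (hGCH : EdgeFamily.GCH.{u}) (κ lam : Cardinal.{u})
    (hκ : Cardinal.aleph 2 ≤ κ) (hlam : κ ≤ lam) :
    EdgeFamily.MaxWO lam {κ} 2 Cardinal.aleph0 ∧
      EdgeFamily.MinVC lam (Set.Iio Cardinal.aleph0 ∪ {κ}) 2 Cardinal.aleph0 := by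
  have hκ' : Order.succ Cardinal.aleph0 < κ := by
    rw [Cardinal.succ_aleph0]
    exact (Cardinal.aleph_lt_aleph.2 one_lt_two).trans_le hκ
  have hω : Cardinal.aleph0 < κ := (Order.lt_succ _).trans hκ'
  exact mainTheorem2_general lam le_rfl hκ' fun ν hν c hc =>
    hGCH.power_le (hω.trans_le hν) (hω.trans_le hν) hc
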